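/- All posets are finite and non-empty. A copy of a poset $Q$ in a poset $P$ is an induced subposet of $P$ isomorphic to $Q$. Let $Q_n$ be the Boolean lattice of dimension $n$, i.e. the subsets of an $n$-element set ordered by inclusion. For posets $P,Q$ let $R(P,Q)$ be the least $N\in\mathbb{N}$ such that every coloring of the elements of $Q_N$ with the colors blue and red contains a blue copy of $P$ or a red copy of $Q$. Let $h(P)$ and $w(P)$ be the largest number of pairwise comparable, respectively pairwise incomparable, elements of $P$, and let $\alpha(m)$ be the least $N$ such that $Q_N$ contains an antichain of size $m$. Let $\Lambda$ be the poset on $z_1,z_2,z_3$ with $z_1>z_2$, $z_1>z_3$ and $z_2,z_3$ incomparable, and let $V$ be the poset on $z_1,z_2,z_3$ with $z_1<z_2$, $z_1<z_3$ and $z_2,z_3$ incomparable. A poset is *trivial* if it contains neither a copy of $\Lambda$ nor a copy of $V$, and *non-trivial* otherwise. Write $\log$ for the logarithm to base $2$. Theorem. Let $P$ be a poset. (0) $P$ is trivial if and only if it is a parallel composition (a disjoint union with no comparabilities between different parts) of one or more non-empty chains. (i) If $P$ is trivial, then for every integer $n\ge 1$, $$n+h(P)-1\le R(P,Q_n)\le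 n+h(P)+\alpha(w(P))-1.$$ In particular $R(P,Q_n)-n=O(1)$ as $n\to\infty$ for fixed $P$; if moreover $|P|\ge 2$, then $R(P,Q_n)=n+\Theta(1)$. (ii) If $P$ is non-trivial, then for every integer $n\ge 2^{16}$, $$R(P,Q_n)\ge n+\frac{1}{15}\cdot\frac{n}{\log n}.$$ Moreover, $R(\Lambda,Q_n)\ge n+\frac{1}{15}\cdot\frac{n}{\log n}$ for every integer $n\ge 2^{16}$. -/

import Mathlib

open Filter Asymptotics

/-- The Boolean lattice `Q_n` of dimension `n`: all subsets of an `n`-element set, ordered by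
inclusion. -/
abbrev BooleanLattice (n : ℕ) : Type := Finset (Fin n)

/-- The two colors. -/
inductive Color where
  | blue
  | red

/-- `P` contains an (induced) copy of `Q`. -/
def ContainsCopy (P Q : Type*) [PartialOrder P] [PartialOrder Q] : Prop :=
  Nonempty (Q ↪o P)

/-- The coloring `c` of `L` contains an (induced) copy of `P` all of whose vertices have
color `k`. -/
def HasMonoCopy {L : Type*} [PartialOrder L] (c : L → Color) (k : Color)
    (P : Type*) [PartialOrder P] : Prop :=
  ∃ f : P ↪o L, ∀ x, c (f x) = k

/-- The poset Ramsey number `R(P, Q)`: the least `N` such that every blue/red coloring of `Q_N`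
contains a blue copy of `P` or a red copy of `Q`. -/
noncomputable def posetRamsey (P Q : Type*) [PartialOrder P] [PartialOrder Q] : ℕ :=
  sInf {N : ℕ | ∀ c : BooleanLattice N → Color,
    HasMonoCopy c Color.blue P ∨ HasMonoCopy c Color.red Q}

/-- The height `h(P)`: the largest number of pairwise comparable vertices of the (finite)
poset `P`. -/
noncomputable def posetHeight (P : Type*) [PartialOrder P] : ℕ :=
  sSup {k : ℕ | ∃ s : Finset P, IsChain (· ≤ ·) (s : Set P) ∧ s.card = k}

/-- The width `w(P)`: the largest number of pairwise incomparable vertices of the (finite)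
poset `P`. -/
noncomputable def posetWidth (P : Type*) [PartialOrder P] : ℕ :=
  sSup {k : ℕ | ∃ s : Finset P, IsAntichain (· ≤ ·) (s : Set P) ∧ s.card = k}

/-- The Sperner number `α(m)`: the least dimension `N` such that `Q_N` contains an antichain of
size `m`. -/
noncomputable def spernerNumber (m : ℕ) : ℕ :=
  sInf {N : ℕ | ∃ s : Finset (BooleanLattice N),
    IsAntichain (· ≤ ·) (s : Set (BooleanLattice N)) ∧ s.card = m}

/-- The 3-element poset `Λ`: `z₁ > z₂`, `z₁ > z₃`, and `z₂`, `z₃` are incomparable. -/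
inductive PosetLambda where
  | z₁
  | z₂
  | z₃

instance : PartialOrder PosetLambda where
  le x y := x = y ∨ y = PosetLambda.z₁
  le_refl _ := Or.inl rfl
  le_trans := by
    rintro x y z (rfl | rfl) (rfl | rfl) <;> simp
  le_antisymm := by
    rintro x y (rfl | rfl) (h | h) <;> simp_all

/-- The 3-element poset `V`: `z₁ < z₂`, `z₁ < z₃`, and `z₂`, `z₃` are incomparable. -/
inductive PosetV where
  | z₁
  | z₂
  | z₃

instance : PartialOrder PosetV where
  le x y := x = y ∨ x = PosetV.z₁
  le_refl _ := Or.inl rfl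
  le_trans := by
    rintro x y z (rfl | rfl) (rfl | rfl) <;> simp
  le_antisymm := by
    rintro x y (rfl | rfl) (h | h) <;> simp_all

/-- A poset is trivial if it contains neither a copy of `Λ` nor a copy of `V`. -/
def IsTrivialPoset (P : Type*) [PartialOrder P] : Prop :=
  ¬ ContainsCopy P PosetLambda ∧ ¬ ContainsCopy P PosetV

/-- `P` is a parallel composition of finitely many (non-empty, finite) chains. The order on the
sigma type is the disjoint-union order: elements of different summands are incomparable. -/
def IsParallelCompositionOfChains (P : Type*) [PartialOrder P] : Prop :=
  ∃ (ℓ : ℕ) (k : Fin ℓ → ℕ), (∀ i, 0 < k i) ∧ Nonempty (P ≃o (Σ i : Fin ℓ, Fin (k i)))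

/-!
Throughout, a coloring is given by its set of blue elements.

*Trivial posets.* If `X × {0, …, h - 1}` contains no blue chain of `h` elements, map `x` to the
largest length `ℓ x` of a blue diagonal chain `(x₀, 0), …, (x_{j - 1}, j - 1)` with
`x₀ ≤ ⋯ ≤ x_{j - 1} ≤ x`: the graph of the monotone function `ℓ` is a red copy of `X`. Doing this
with `X = Q_n` simultaneously above each element of an antichain yields the upper bound for
parallel compositions of chains.

*Non-trivial posets.* By duality it suffices to treat `Λ`. Color `Q_{n + k}` so that the blue
elements form a disjoint union of trees growing upwards, hence contain no copy of `Λ`. A red copy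
of `Q_n` would be free on some set `Y` of `k` elements of the ground set. It is thus enough to have,
for each such `Y`, a blue tree `B_Y` indexed by the sequences without repetition in `Y`: walking up
this tree according to the behavior of the copy on `Y`, one arrives at a common element. The trees
for different `Y` are made pairwise incomparable by means of codewords at distance more than `2k`,
which still disagree outside both sets. This needs about `k log n` elements of the ground set, so
`k` can be of order `n / log n`.
-/

/-- `Arrows L P Q` is the arrow relation `L → (P, Q)` of Ramsey theory, for an arbitrary poset `L`
in place of the Boolean lattice: every coloring of `L` contains a blue copy of `P` or a red copy
of `Q`. -/
def Arrows (L P Q : Type*) [PartialOrder L] [PartialOrder P] [PartialOrder Q] : Prop :=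
  ∀ c : L → Color, HasMonoCopy c Color.blue P ∨ HasMonoCopy c Color.red Q

section Arrows

variable {L L' P P' Q Q' X Y : Type*} [PartialOrder L] [PartialOrder L'] [PartialOrder P]
  [PartialOrder P'] [PartialOrder Q] [PartialOrder Q'] [PartialOrder X] [PartialOrder Y]

theorem arrows_iff_forall_set : Arrows L P Q ↔
    ∀ S : Set L, (∃ f : P ↪o L, ∀ x, f x ∈ S) ∨ ∃ g : Q ↪o L, ∀ x, g x ∉ S := by
  classical
  constructor
  · intro h S
    simpa [HasMonoCopy] using h fun a ↦ if a ∈ S then .blue else .red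
  · intro h c
    have hred (a : L) : a ∉ {a | c a = .blue} → c a = .red := by
      cases hc : c a <;> simp [hc]
    exact (h {a | c a = .blue}).imp_right fun ⟨g, hg⟩ ↦ ⟨g, fun x ↦ hred _ (hg x)⟩

theorem Arrows.mono_host (h : Arrows L P Q) (e : L ↪o L') : Arrows L' P Q := fun c ↦
  (h (c ∘ e)).imp (fun ⟨f, hf⟩ ↦ ⟨f.trans e, hf⟩) fun ⟨g, hg⟩ ↦ ⟨g.trans e, hg⟩

theorem Arrows.mono_blue (h : Arrows L P Q) (e : P' ↪o P) : Arrows L P' Q := fun c ↦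
  (h c).imp_left fun ⟨f, hf⟩ ↦ ⟨e.trans f, fun x ↦ hf (e x)⟩

theorem Arrows.mono_red (h : Arrows L P Q) (e : Q' ↪o Q) : Arrows L P Q' := fun c ↦
  (h c).imp_right fun ⟨g, hg⟩ ↦ ⟨e.trans g, fun x ↦ hg (e x)⟩

theorem Arrows.dual (h : Arrows L P Q) : Arrows Lᵒᵈ Pᵒᵈ Qᵒᵈ := fun c ↦
  (h (c ∘ OrderDual.toDual)).imp (fun ⟨f, hf⟩ ↦ ⟨f.dual, hf⟩) fun ⟨g, hg⟩ ↦ ⟨g.dual, hg⟩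

/-- Either some fibre over `P` is entirely red, or choosing a blue element from each fibre yields a
copy of `P`. -/
theorem arrows_lex : Arrows (P ×ₗ Q) P Q := by
  refine arrows_iff_forall_set.2 fun S ↦ or_iff_not_imp_right.2 fun hred ↦ ?_
  have hblue (x : P) : ∃ y : Q, toLex (x, y) ∈ S := by
    by_contra! hx
    exact hred ⟨.ofMapLEIff (fun y ↦ toLex (x, y)) fun y y' ↦ by simp [Prod.Lex.toLex_le_toLex'],
      hx⟩
  choose y hy using hblue
  refine ⟨.ofMapLEIff (fun x ↦ toLex (x, y x)) fun x x' ↦ ?_, hy⟩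
  rw [Prod.Lex.toLex_le_toLex']
  exact and_iff_left_of_imp fun _ hx ↦ (congrArg y hx).le

theorem Arrows.sigma {ι : Type*} {R : ι → Type*} [∀ i, PartialOrder (R i)] {T : ι → X}
    (hT : ∀ i j, T i ≤ T j → i = j) (h : ∀ i, Arrows Y (R i) Q) :
    Arrows (X × Y) (Σ i, R i) Q := by
  refine arrows_iff_forall_set.2 fun S ↦ or_iff_not_imp_right.2 fun hred ↦ ?_
  have hblue (i : ι) : ∃ f : R i ↪o Y, ∀ x, (T i, f x) ∈ S := by
    refine (arrows_iff_forall_set.1 (h i) {y | (T i, y) ∈ S}).resolve_right fun ⟨g, hg⟩ ↦ hred ?_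
    exact ⟨.ofMapLEIff (fun x ↦ (T i, g x)) fun x x' ↦ by simp, hg⟩
  choose f hf using hblue
  refine ⟨.ofMapLEIff (fun x ↦ (T x.1, f x.1 x.2)) ?_, fun x ↦ hf _ _⟩
  rintro ⟨i, a⟩ ⟨j, b⟩
  constructor
  · rintro ⟨hij, hab⟩
    obtain rfl := hT i j hij
    exact Sigma.mk_le_mk_iff.2 ((f i).le_iff_le.1 hab)
  · rintro ⟨i, a, b, hab⟩
    exact ⟨le_rfl, (f i).le_iff_le.2 hab⟩

theorem not_arrows_self [Finite L] [Nonempty L] [Nontrivial P] : ¬ Arrows L P L := fun h ↦ by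
  obtain ⟨a⟩ := ‹Nonempty L›
  rcases arrows_iff_forall_set.1 h {a} with ⟨f, hf⟩ | ⟨g, hg⟩
  · obtain ⟨x, y, hxy⟩ := exists_pair_ne P
    exact hxy (f.injective ((hf x).trans (hf y).symm))
  · obtain ⟨x, hx⟩ := Finite.surjective_of_injective g.injective a
    exact hg x hx

end Arrows

section Diagonal

variable {X : Type*} [PartialOrder X] {S : Set (X × ℕ)} {j : ℕ} {x y : X}

/-- There is a weakly increasing sequence below `x` whose first `j` terms, paired with their
indices, lie in `S`. -/
def HasDiagonalChain (S : Set (X × ℕ)) (j : ℕ) (x : X) : Prop :=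
  ∃ B : ℕ → X, Monotone B ∧ (∀ i, B i ≤ x) ∧ ∀ i < j, (B i, i) ∈ S

theorem hasDiagonalChain_zero : HasDiagonalChain S 0 x :=
  ⟨fun _ ↦ x, monotone_const, fun _ ↦ le_rfl, by simp⟩

theorem HasDiagonalChain.mono (h : HasDiagonalChain S j x) (hxy : x ≤ y) :
    HasDiagonalChain S j y := by
  obtain ⟨B, hB, hBx, hBS⟩ := h
  exact ⟨B, hB, fun i ↦ (hBx i).trans hxy, hBS⟩

theorem HasDiagonalChain.succ (h : HasDiagonalChain S j x) (hx : (x, j) ∈ S) :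
    HasDiagonalChain S (j + 1) x := by
  obtain ⟨B, hB, hBx, hBS⟩ := h
  refine ⟨fun i ↦ if i < j then B i else x, fun i i' hi ↦ ?_, fun i ↦ ?_, fun i hi ↦ ?_⟩ <;>
    dsimp only
  · split_ifs
    · exact hB hi
    · exact hBx i
    · omega
    · exact le_rfl
  · split_ifs
    · exact hBx i
    · exact le_rfl
  · split_ifs with hij
    · exact hBS i hij
    · obtain rfl : i = j := by omega
      exact hx

theorem exists_hasDiagonalChain_or_exists_monotone (S : Set (X × ℕ)) (h : ℕ) :
    (∃ x, HasDiagonalChain S h x) ∨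
      ∃ ℓ : X → ℕ, Monotone ℓ ∧ (∀ x, ℓ x < h) ∧ ∀ x, (x, ℓ x) ∉ S := by
  classical
  refine or_iff_not_imp_left.2 fun hlong ↦ ?_
  push Not at hlong
  let ℓ (x : X) : ℕ := Nat.findGreatest (HasDiagonalChain S · x) h
  have hℓ (x : X) : HasDiagonalChain S (ℓ x) x :=
    Nat.findGreatest_spec (P := (HasDiagonalChain S · x)) h.zero_le hasDiagonalChain_zero
  have hℓh (x : X) : ℓ x < h :=
    (Nat.findGreatest_le h).lt_of_ne fun heq ↦ hlong x (heq ▸ hℓ x)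
  refine ⟨ℓ, fun x y hxy ↦ Nat.le_findGreatest (hℓh x).le ((hℓ x).mono hxy), hℓh, fun x hx ↦ ?_⟩
  exact (Nat.le_findGreatest (hℓh x) ((hℓ x).succ hx)).not_gt (Nat.lt_succ_self _)

/-- A red copy of `X` is found as the graph of a monotone function, the largest length of a
diagonal blue chain below a given element. -/
theorem arrows_prod_fin (X : Type*) [PartialOrder X] (h : ℕ) : Arrows (X × Fin h) (Fin h) X := by
  refine arrows_iff_forall_set.2 fun S ↦ ?_
  rcases exists_hasDiagonalChain_or_exists_monotone (Prod.map id Fin.val '' S) h with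
    ⟨_, B, hB, -, hBS⟩ | ⟨ℓ, hℓ, hℓh, hℓS⟩
  · refine .inl ⟨.ofMapLEIff (fun i ↦ (B i, i)) fun i j ↦ ?_, fun i ↦ ?_⟩
    · exact and_iff_right_of_imp fun hij ↦ hB hij
    · simpa [Fin.val_inj] using hBS i i.2
  · refine .inr ⟨.ofMapLEIff (fun x ↦ (x, ⟨ℓ x, hℓh x⟩)) fun x y ↦ ?_,
      fun x hx ↦ hℓS x ⟨_, hx, rfl⟩⟩
    exact and_iff_left_of_imp fun hxy ↦ hℓ hxy

end Diagonal

section BooleanLattice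

theorem exists_orderEmbedding_finset (P : Type*) [PartialOrder P] [Finite P] :
    Nonempty (P ↪o Finset P) :=
  ⟨.ofMapLEIff (fun x ↦ (Set.toFinite (Set.Iic x)).toFinset) fun x y ↦ by
    simp [Set.Iic_subset_Iic]⟩

theorem exists_orderEmbedding_fin_finset (n : ℕ) : Nonempty (Fin (n + 1) ↪o Finset (Fin n)) := by
  refine ⟨.ofMapLEIff (fun j ↦ Finset.univ.filter fun i : Fin n ↦ i.castSucc < j) fun j j' ↦
    ⟨fun h ↦ ?_, fun h i hi ↦ ?_⟩⟩
  · by_contra! hlt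
    have := @h (j'.castPred (Fin.ne_last_of_lt hlt)) (by simpa using hlt)
    simp at this
  · simp only [Finset.mem_filter, Finset.mem_univ, true_and] at hi ⊢
    exact hi.trans_le h

theorem Arrows.posetRamsey_le {α P Q : Type*} [Fintype α] [PartialOrder P] [PartialOrder Q]
    (h : Arrows (Finset α) P Q) : posetRamsey P Q ≤ Fintype.card α :=
  Nat.sInf_le (h.mono_host (Finset.mapEmbedding (Fintype.equivFin α).toEmbedding))

variable {P Q : Type*} [PartialOrder P] [PartialOrder Q] [Finite P] [Finite Q]

theorem arrows_posetRamsey : Arrows (BooleanLattice (posetRamsey P Q)) P Q := by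
  have : Finite (P ×ₗ Q) := inferInstanceAs (Finite (P × Q))
  obtain ⟨f⟩ := exists_orderEmbedding_finset (P ×ₗ Q)
  exact Nat.sInf_mem (s := {N | Arrows (BooleanLattice N) P Q})
    ⟨_, arrows_lex.mono_host (f.trans (Finset.mapEmbedding (Finite.equivFin _).toEmbedding))⟩

theorem lt_posetRamsey {N : ℕ} (h : ¬ Arrows (BooleanLattice N) P Q) : N < posetRamsey P Q := by
  by_contra! hle
  exact h (arrows_posetRamsey.mono_host (Finset.mapEmbedding (Fin.castLEEmb hle)))

end BooleanLattice

section Parameters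

variable {P : Type*} [PartialOrder P]

theorem posetHeight_le_of_strictMono {r : P → ℕ} (hr : StrictMono r) {m : ℕ} (hm : ∀ x, r x < m) :
    posetHeight P ≤ m := by
  refine csSup_le ⟨0, ∅, by simp, rfl⟩ ?_
  rintro _ ⟨s, hs, rfl⟩
  have hinj : Set.InjOn r s := fun x hx y hy hxy ↦ by
    by_contra hne
    rcases hs hx hy hne with hle | hle
    · exact (hr (hle.lt_of_ne hne)).ne hxy
    · exact (hr (hle.lt_of_ne' hne)).ne' hxy
  simpa using Finset.card_le_card_of_injOn (t := Finset.range m) r (fun x _ ↦ by simpa using hm x)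
    hinj

theorem le_posetHeight_of_orderEmbedding [Finite P] {k : ℕ} (f : Fin k ↪o P) :
    k ≤ posetHeight P := by
  have := Fintype.ofFinite P
  refine le_csSup ⟨Fintype.card P, ?_⟩
    ⟨Finset.univ.map f.toEmbedding, ?_, by simp⟩
  · rintro _ ⟨s, -, rfl⟩
    exact s.card_le_univ
  · simpa using f.monotone.isChain_range

theorem posetHeight_pos [Finite P] [Nonempty P] : 0 < posetHeight P := by
  obtain ⟨x⟩ := ‹Nonempty P›
  exact le_posetHeight_of_orderEmbedding
    (.ofMapLEIff (fun _ : Fin 1 ↦ x) fun i j ↦ by simp [Subsingleton.elim i j])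

theorem card_le_posetWidth [Finite P] {ι : Type*} [Fintype ι] {T : ι → P}
    (hT : ∀ i j, T i ≤ T j → i = j) : Fintype.card ι ≤ posetWidth P := by
  have := Fintype.ofFinite P
  have hinj : Function.Injective T := fun i j hij ↦ hT i j hij.le
  refine le_csSup ⟨Fintype.card P, ?_⟩ ⟨Finset.univ.map ⟨T, hinj⟩, ?_, by simp⟩
  · rintro _ ⟨s, -, rfl⟩
    exact s.card_le_univ
  · simp only [Finset.coe_map, Function.Embedding.coeFn_mk, Finset.coe_univ, Set.image_univ]
    rintro _ ⟨i, rfl⟩ _ ⟨j, rfl⟩ hne hle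
    exact hne (congrArg T (hT i j hle))

theorem exists_antichain_spernerNumber {ι : Type*} [Fintype ι] {m : ℕ} (hm : Fintype.card ι ≤ m) :
    ∃ T : ι → BooleanLattice (spernerNumber m), ∀ i j, T i ≤ T j → i = j := by
  obtain ⟨s, hs, hsm⟩ : ∃ s : Finset (BooleanLattice (spernerNumber m)),
      IsAntichain (· ≤ ·) (s : Set (BooleanLattice (spernerNumber m))) ∧ s.card = m := by
    refine Nat.sInf_mem (s := {N : ℕ | ∃ s : Finset (BooleanLattice N),
      IsAntichain (· ≤ ·) (s : Set (BooleanLattice N)) ∧ s.card = m})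
      ⟨m, Finset.univ.map ⟨_, Finset.singleton_injective⟩, ?_, by simp⟩
    simp only [Finset.coe_map, Function.Embedding.coeFn_mk, Finset.coe_univ, Set.image_univ]
    rintro _ ⟨i, rfl⟩ _ ⟨j, rfl⟩ hne hle
    exact hne (congrArg _ (by simpa using hle))
  obtain ⟨T⟩ : Nonempty (ι ↪ s) := Function.Embedding.nonempty_of_card_le (by simpa [hsm] using hm)
  exact ⟨fun i ↦ T i, fun i j hij ↦
    T.injective (Subtype.ext (hs.eq (T i).2 (T j).2 hij))⟩

/-- Coloring the elements of rank less than `h(P) - 1` blue leaves too few red ranks for `Q`. -/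
theorem Arrows.posetHeight_add_posetHeight_le [Finite P] [Nonempty P] {L Q : Type*}
    [PartialOrder L] [PartialOrder Q] [Nonempty Q] (h : Arrows L P Q) {r : L → ℕ}
    (hr : StrictMono r) {N : ℕ} (hN : ∀ a, r a ≤ N) : posetHeight P + posetHeight Q ≤ N + 2 := by
  have hP := posetHeight_pos (P := P)
  rcases arrows_iff_forall_set.1 h {a | r a < posetHeight P - 1} with ⟨f, hf⟩ | ⟨g, hg⟩
  · have := posetHeight_le_of_strictMono (hr.comp f.strictMono) hf
    omega
  · simp only [Set.mem_ofPred_eq, not_lt] at hg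
    have hle (x : Q) := hN (g x)
    have := posetHeight_le_of_strictMono (r := fun x ↦ r (g x) - (posetHeight P - 1))
      (m := N + 1 - (posetHeight P - 1))
      (fun x y hxy ↦ Nat.sub_lt_sub_right (hg x) (hr (g.strictMono hxy)))
      (fun x ↦ by have := hg x; have := hle x; omega)
    obtain ⟨x⟩ := ‹Nonempty Q›
    have := hg x
    have := hle x
    omega

end Parameters

section Trivial

variable {P : Type*} [PartialOrder P]

instance : Finite PosetLambda :=
  .of_surjective (![.z₁, .z₂, .z₃] : Fin 3 → PosetLambda)
    (by rintro (_ | _ | _); exacts [⟨0, rfl⟩, ⟨1, rfl⟩, ⟨2, rfl⟩])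

theorem nonempty_orderIso_v_dual_lambda : Nonempty (PosetV ≃o PosetLambdaᵒᵈ) := by
  let e : PosetV ≃ PosetLambda :=
    { toFun := fun | .z₁ => .z₁ | .z₂ => .z₂ | .z₃ => .z₃
      invFun := fun | .z₁ => .z₁ | .z₂ => .z₂ | .z₃ => .z₃
      left_inv := by rintro (_ | _ | _) <;> rfl
      right_inv := by rintro (_ | _ | _) <;> rfl }
  refine ⟨⟨e.trans OrderDual.toDual, @fun x y ↦ ?_⟩⟩
  change e y = e x ∨ e x = e .z₁ ↔ x = y ∨ x = .z₁
  simp only [e.apply_eq_iff_eq, eq_comm]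

theorem containsCopy_lambda_iff :
    ContainsCopy P PosetLambda ↔ ∃ a b c : P, b ≤ a ∧ c ≤ a ∧ ¬ b ≤ c ∧ ¬ c ≤ b := by
  constructor
  · rintro ⟨f⟩
    refine ⟨f .z₁, f .z₂, f .z₃, ?_, ?_, ?_, ?_⟩ <;> rw [f.le_iff_le]
    · exact .inr rfl
    · exact .inr rfl
    · rintro (h | h) <;> cases h
    · rintro (h | h) <;> cases h
  · rintro ⟨a, b, c, hb, hc, hbc, hcb⟩
    have hab : ¬ a ≤ b := fun h ↦ hcb (hc.trans h)
    have hac : ¬ a ≤ c := fun h ↦ hbc (hb.trans h)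
    refine ⟨.ofMapLEIff (fun | .z₁ => a | .z₂ => b | .z₃ => c) fun x y ↦ ?_⟩
    change _ ↔ x = y ∨ y = PosetLambda.z₁
    cases x <;> cases y <;> simp [*]

theorem containsCopy_v_iff_dual : ContainsCopy P PosetV ↔ ContainsCopy Pᵒᵈ PosetLambda := by
  obtain ⟨e⟩ := nonempty_orderIso_v_dual_lambda
  exact ⟨fun ⟨f⟩ ↦ ⟨e.dual.symm.toOrderEmbedding.trans f.dual⟩,
    fun ⟨f⟩ ↦ ⟨e.toOrderEmbedding.trans f.dual⟩⟩

theorem containsCopy_v_iff :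
    ContainsCopy P PosetV ↔ ∃ a b c : P, a ≤ b ∧ a ≤ c ∧ ¬ b ≤ c ∧ ¬ c ≤ b :=
  containsCopy_v_iff_dual.trans <| containsCopy_lambda_iff.trans
    ⟨fun ⟨a, b, c, hb, hc, hbc, hcb⟩ ↦ ⟨a, b, c, hb, hc, hcb, hbc⟩,
      fun ⟨a, b, c, hb, hc, hbc, hcb⟩ ↦ ⟨a, b, c, hb, hc, hcb, hbc⟩⟩

theorem isTrivialPoset_iff_comparable_trans :
    IsTrivialPoset P ↔ ∀ x y z : P, x ≤ y ∨ y ≤ x → y ≤ z ∨ z ≤ y → x ≤ z ∨ z ≤ x := by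
  rw [IsTrivialPoset, containsCopy_lambda_iff, containsCopy_v_iff]
  constructor
  · rintro ⟨hΛ, hV⟩ x y z (hxy | hxy) (hyz | hyz) <;> push Not at hΛ hV
    · exact .inl (hxy.trans hyz)
    · exact or_iff_not_imp_left.2 (hΛ y x z hxy hyz)
    · exact or_iff_not_imp_left.2 (hV y x z hxy hyz)
    · exact .inr (hyz.trans hxy)
  · refine fun h ↦ ⟨?_, ?_⟩ <;> rintro ⟨a, b, c, hb, hc, hbc, hcb⟩
    · exact (h b a c (.inl hb) (.inr hc)).elim hbc hcb
    · exact (h b a c (.inr hb) (.inl hc)).elim hbc hcb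

theorem nonempty_orderIso_fin_of_total [Finite P] (h : ∀ x y : P, x ≤ y ∨ y ≤ x) :
    Nonempty (P ≃o Fin (Nat.card P)) := by
  classical
  have := Fintype.ofFinite P
  let _ : LinearOrder P :=
    { ‹PartialOrder P› with
      le_total := h
      toDecidableLE := Classical.decRel _ }
  exact ⟨(Fintype.orderIsoFinOfCardEq P Nat.card_eq_fintype_card.symm).symm⟩

theorem nonempty_orderIso_sigma_of_fiber {ι : Type*} {p : P → ι} (hp : ∀ x y, x ≤ y → p x = p y)
    {R : ι → Type*} [∀ i, LE (R i)] (e : ∀ i, {x // p x = i} ≃o R i) :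
    Nonempty (P ≃o Σ i, R i) := by
  refine ⟨.symm
    { toEquiv := (Equiv.sigmaCongrRight fun i ↦ (e i).symm.toEquiv).trans (Equiv.sigmaFiberEquiv p)
      map_rel_iff' := ?_ }⟩
  rintro ⟨i, a⟩ ⟨j, b⟩
  change ((e i).symm a : P) ≤ (e j).symm b ↔ _
  constructor
  · intro hle
    obtain rfl : i = j := ((e i).symm a).2.symm.trans ((hp _ _ hle).trans ((e j).symm b).2)
    exact Sigma.mk_le_mk_iff.2 ((e i).symm.le_iff_le.1 hle)
  · rintro ⟨i, a, b, hab⟩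
    exact (e i).symm.le_iff_le.2 hab

theorem IsTrivialPoset.isParallelCompositionOfChains [Finite P] (h : IsTrivialPoset P) :
    IsParallelCompositionOfChains P := by
  let s : Setoid P :=
    { r := fun x y ↦ x ≤ y ∨ y ≤ x
      iseqv := ⟨fun x ↦ .inl le_rfl, Or.symm, isTrivialPoset_iff_comparable_trans.1 h _ _ _⟩ }
  let p : P → Fin (Nat.card (Quotient s)) := fun x ↦ Finite.equivFin _ (Quotient.mk s x)
  have hp {x y : P} : p x = p y ↔ (x ≤ y ∨ y ≤ x) :=
    (Finite.equivFin (Quotient s)).apply_eq_iff_eq.trans Quotient.eq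
  have hsurj : Function.Surjective p := (Equiv.surjective _).comp Quotient.mk_surjective
  have hfiber (i) : Nonempty ({x // p x = i} ≃o Fin (Nat.card {x // p x = i})) :=
    nonempty_orderIso_fin_of_total fun x y ↦ hp.1 (x.2.trans y.2.symm)
  refine ⟨_, fun i ↦ Nat.card {x // p x = i}, fun i ↦ ?_,
    nonempty_orderIso_sigma_of_fiber (fun x y hxy ↦ hp.2 (.inl hxy)) fun i ↦ (hfiber i).some⟩
  have : Nonempty {x // p x = i} := let ⟨x, hx⟩ := hsurj i; ⟨⟨x, hx⟩⟩
  exact Nat.card_pos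

theorem sigma_comparable_iff_fst_eq {ι : Type*} {R : ι → Type*} [∀ i, LinearOrder (R i)]
    {a b : Σ i, R i} : a ≤ b ∨ b ≤ a ↔ a.1 = b.1 := by
  constructor
  · rintro (⟨i, _, _, _⟩ | ⟨i, _, _, _⟩) <;> rfl
  · obtain ⟨i, a⟩ := a
    obtain ⟨j, b⟩ := b
    rintro (rfl : i = j)
    simpa only [Sigma.mk_le_mk_iff] using le_total a b

theorem IsParallelCompositionOfChains.isTrivialPoset (h : IsParallelCompositionOfChains P) :
    IsTrivialPoset P := by
  obtain ⟨ℓ, k, -, ⟨e⟩⟩ := h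
  refine isTrivialPoset_iff_comparable_trans.2 fun x y z hxy hyz ↦ ?_
  simp only [← e.le_iff_le, sigma_comparable_iff_fst_eq] at hxy hyz ⊢
  exact hxy.trans hyz

theorem isTrivialPoset_iff_isParallelCompositionOfChains [Finite P] :
    IsTrivialPoset P ↔ IsParallelCompositionOfChains P :=
  ⟨(·.isParallelCompositionOfChains), (·.isTrivialPoset)⟩

end Trivial

section TrivialBounds

variable {P : Type*} [PartialOrder P] [Finite P]

theorem IsParallelCompositionOfChains.arrows (hP : IsParallelCompositionOfChains P) (X : Type*)
    [PartialOrder X] :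
    Arrows (BooleanLattice (spernerNumber (posetWidth P)) × X × Fin (posetHeight P)) P X := by
  obtain ⟨ℓ, k, hk, ⟨e⟩⟩ := hP
  have hbottoms : ∀ i j, e.symm ⟨i, 0, hk i⟩ ≤ e.symm ⟨j, 0, hk j⟩ → i = j := fun i j hij ↦
    sigma_comparable_iff_fst_eq.1 (.inl (e.symm.le_iff_le.1 hij))
  have hheight (i : Fin ℓ) : k i ≤ posetHeight P := le_posetHeight_of_orderEmbedding <|
    .ofMapLEIff (fun j ↦ e.symm ⟨i, j⟩) fun j j' ↦ by simp
  obtain ⟨T, hT⟩ := exists_antichain_spernerNumber (card_le_posetWidth hbottoms)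
  have hchain (i : Fin ℓ) : Arrows (X × Fin (posetHeight P)) (Fin (k i)) X :=
    (arrows_prod_fin X (posetHeight P)).mono_blue (Fin.castLEOrderEmb (hheight i))
  exact (Arrows.sigma hT hchain).mono_blue e.toOrderEmbedding

theorem IsTrivialPoset.posetRamsey_le [Nonempty P] (hP : IsTrivialPoset P) (n : ℕ) :
    posetRamsey P (BooleanLattice n) ≤ n + posetHeight P + spernerNumber (posetWidth P) - 1 := by
  have harrows := hP.isParallelCompositionOfChains.arrows (BooleanLattice n)
  obtain ⟨h, hh⟩ := Nat.exists_eq_add_of_le' (posetHeight_pos (P := P))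
  rw [hh] at harrows ⊢
  obtain ⟨f⟩ := exists_orderEmbedding_fin_finset h
  let host : BooleanLattice (spernerNumber (posetWidth P)) × BooleanLattice n × Fin (h + 1) ↪o
      Finset (Fin (spernerNumber (posetWidth P)) ⊕ Fin n ⊕ Fin h) :=
    .ofMapLEIff (fun x ↦ Finset.sumEquiv.symm (x.1, Finset.sumEquiv.symm (x.2.1, f x.2.2)))
      fun x y ↦ by simp only [OrderIso.le_iff_le, OrderEmbedding.le_iff_le, Prod.le_def]
  have := (harrows.mono_host host).posetRamsey_le
  simp only [Fintype.card_sum, Fintype.card_fin] at this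
  omega

variable (P) in
theorem add_posetHeight_sub_one_le_posetRamsey [Nonempty P] (n : ℕ) :
    n + posetHeight P - 1 ≤ posetRamsey P (BooleanLattice n) := by
  obtain ⟨f⟩ := exists_orderEmbedding_fin_finset n
  have hcube : n + 1 ≤ posetHeight (BooleanLattice n) := le_posetHeight_of_orderEmbedding f
  have := (arrows_posetRamsey (P := P) (Q := BooleanLattice n)).posetHeight_add_posetHeight_le
    Finset.card_strictMono (N := posetRamsey P (BooleanLattice n)) fun A ↦ by
      simpa using A.card_le_univ
  omega

theorem IsTrivialPoset.isBigO_posetRamsey_sub [Nonempty P] (hP : IsTrivialPoset P) :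
    (fun n : ℕ ↦ (posetRamsey P (BooleanLattice n) : ℝ) - n) =O[atTop] (fun _ ↦ (1 : ℝ)) := by
  refine .of_bound ((posetHeight P + spernerNumber (posetWidth P) : ℕ) : ℝ) (.of_forall fun n ↦ ?_)
  have hupper := hP.posetRamsey_le n
  have hlower := add_posetHeight_sub_one_le_posetRamsey P n
  have hpos := posetHeight_pos (P := P)
  have hle : (n : ℝ) ≤ posetRamsey P (BooleanLattice n) := by
    exact_mod_cast (show n ≤ posetRamsey P (BooleanLattice n) by omega)
  rw [Real.norm_of_nonneg (sub_nonneg.2 hle), norm_one, mul_one, sub_le_iff_le_add']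
  exact_mod_cast (show posetRamsey P (BooleanLattice n) ≤
    n + (posetHeight P + spernerNumber (posetWidth P)) by omega)

theorem IsTrivialPoset.isTheta_posetRamsey_sub [Nontrivial P] (hP : IsTrivialPoset P) :
    (fun n : ℕ ↦ (posetRamsey P (BooleanLattice n) : ℝ) - n) =Θ[atTop] (fun _ ↦ (1 : ℝ)) := by
  refine ⟨hP.isBigO_posetRamsey_sub, .of_bound 1 (.of_forall fun n ↦ ?_)⟩
  have hlt : (n : ℝ) + 1 ≤ posetRamsey P (BooleanLattice n) := by
    exact_mod_cast lt_posetRamsey (P := P) not_arrows_self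
  rw [norm_one, one_mul]
  exact (le_sub_iff_add_le'.2 hlt).trans (Real.le_norm_self _)

end TrivialBounds

section Code

theorem exists_pairwise_not_and_card_le_card_mul {X : Type*} [Fintype X] {r : X → X → Prop}
    [DecidableRel r] (hrefl : ∀ x, r x x) (hsymm : ∀ x y, r x y → r y x) {V : ℕ}
    (hV : ∀ x, (Finset.univ.filter (r x)).card ≤ V) :
    ∃ C : Finset X, (C : Set X).Pairwise (fun x y ↦ ¬ r x y) ∧ Fintype.card X ≤ C.card * V := by
  classical
  obtain ⟨C, hC⟩ := Set.Finite.exists_maximal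
    (s := {C : Finset X | (C : Set X).Pairwise fun x y ↦ ¬ r x y}) (Set.toFinite _) ⟨∅, by simp⟩
  refine ⟨C, hC.prop, ?_⟩
  have hcover : Finset.univ ⊆ C.biUnion fun x ↦ Finset.univ.filter (r x) := fun y _ ↦ by
    simp only [Finset.mem_biUnion, Finset.mem_filter, Finset.mem_univ, true_and]
    by_contra! hy
    have hpairwise : ((insert y C : Finset X) : Set X).Pairwise fun x y ↦ ¬ r x y := by
      rw [Finset.coe_insert]
      exact hC.prop.insert fun x hx _ ↦ ⟨fun hyx ↦ hy x hx (hsymm y x hyx), hy x hx⟩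
    exact hy y (hC.le_of_ge hpairwise (Finset.subset_insert y C) (Finset.mem_insert_self y C))
      (hrefl y)
  exact (Finset.card_le_card hcover).trans (Finset.card_biUnion_le_card_mul _ _ _ fun x _ ↦ hV x)

variable {ι β : Type*} [Fintype ι] [DecidableEq β]

theorem hammingDist_update_lt [DecidableEq ι] {x y : ι → β} {i : ι} (hi : x i ≠ y i) :
    hammingDist x (Function.update y i (x i)) < hammingDist x y := by
  refine Finset.card_lt_card (Finset.ssubset_iff_of_subset (fun j hj ↦ ?_) |>.2 ⟨i, ?_, ?_⟩)
  · rcases eq_or_ne j i with rfl | hji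
    · simp at hj
    · simpa [hji] using hj
  · simpa using hi
  · simp

variable [Fintype β]

theorem card_hammingDist_le_le [DecidableEq ι] (x : ι → β) (t : ℕ) :
    (Finset.univ.filter fun y ↦ hammingDist x y ≤ t).card ≤
      (Fintype.card ι * Fintype.card β + 1) ^ t := by
  induction t with
  | zero => simp [hammingDist_eq_zero, Finset.filter_eq]
  | succ t ih =>
    let change (p : (ι → β) × Option (ι × β)) : ι → β :=
      p.2.elim p.1 fun q ↦ Function.update p.1 q.1 q.2
    have hsubset : (Finset.univ.filter fun y ↦ hammingDist x y ≤ t + 1) ⊆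
        ((Finset.univ.filter fun y ↦ hammingDist x y ≤ t) ×ˢ Finset.univ).image change := by
      intro y hy
      simp only [Finset.mem_filter, Finset.mem_univ, true_and, Finset.mem_image,
        Finset.mem_product, and_true] at hy ⊢
      rcases eq_or_ne x y with rfl | hxy
      · exact ⟨(x, none), by simp, rfl⟩
      · obtain ⟨i, hi⟩ := Function.ne_iff.1 hxy
        exact ⟨(Function.update y i (x i), some (i, y i)),
          Nat.le_of_lt_succ ((hammingDist_update_lt hi).trans_le hy), by simp [change]⟩
    calc _ ≤ _ := Finset.card_le_card hsubset
      _ ≤ _ := Finset.card_image_le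
      _ ≤ (Fintype.card ι * Fintype.card β + 1) ^ t * (Fintype.card ι * Fintype.card β + 1) := by
        rw [Finset.card_product, Finset.card_univ, Fintype.card_option, Fintype.card_prod]
        gcongr

/-- The Gilbert–Varshamov bound, with a crude estimate for the size of Hamming balls. -/
theorem exists_lt_hammingDist {κ : Type*} [Fintype κ] (t : ℕ)
    (h : Fintype.card κ * (Fintype.card ι * Fintype.card β + 1) ^ t ≤
      Fintype.card β ^ Fintype.card ι) :
    ∃ c : κ → ι → β, ∀ i j, i ≠ j → t < hammingDist (c i) (c j) := by
  classical
  obtain ⟨C, hC, hcard⟩ := exists_pairwise_not_and_card_le_card_mul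
    (r := fun x y : ι → β ↦ hammingDist x y ≤ t) (by simp)
    (fun x y ↦ (hammingDist_comm x y ▸ ·)) (card_hammingDist_le_le · t)
  rw [Fintype.card_fun] at hcard
  obtain ⟨c⟩ : Nonempty (κ ↪ C) := Function.Embedding.nonempty_of_card_le <| by
    simpa using Nat.le_of_mul_le_mul_right (h.trans hcard) (by positivity)
  exact ⟨fun i ↦ c i, fun i j hij ↦
    not_le.1 (hC (c i).2 (c j).2 fun hc ↦ hij (c.injective (Subtype.ext hc)))⟩

end Code

section Shrub

variable {Z α : Type*} {Y : Finset Z} {S : List Z}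

/-- `S` lists without repetition the elements of some subset of `Y`; following the paper, such a
linearly ordered subset of `Y` is called an ordered subset of `Y`. -/
def IsOrderedSubset (Y : Finset Z) (S : List Z) : Prop :=
  S.Nodup ∧ ∀ y ∈ S, y ∈ Y

theorem IsOrderedSubset.length_le (hS : IsOrderedSubset Y S) : S.length ≤ Y.card :=
  Multiset.card_le_card ((Multiset.le_iff_subset (Multiset.coe_nodup.2 hS.1)).2 hS.2)

theorem isOrderedSubset_nil : IsOrderedSubset Y [] :=
  ⟨List.nodup_nil, by simp⟩

theorem IsOrderedSubset.concat (hS : IsOrderedSubset Y S) {y : Z} (hy : y ∈ Y) (hyS : y ∉ S) :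
    IsOrderedSubset Y (S ++ [y]) := by
  refine ⟨List.nodup_append.2 ⟨hS.1, by simp, ?_⟩, ?_⟩
  · rintro z hz w hw rfl
    exact hyS (List.mem_singleton.1 hw ▸ hz)
  · simpa [or_imp, forall_and] using ⟨hS.2, hy⟩

/-- A `Y`-shrub: vertices `B S`, one for each ordered subset `S` of `Y`, which are ordered like the
tree of ordered subsets of `Y` (by the prefix relation) and such that `B S` meets `Y` exactly in
the elements of `S`. The values of `B` at other lists are irrelevant. -/
structure IsShrub (Y : Finset Z) (B : List Z → Finset Z) : Prop where
  subset_iff_prefix : ∀ {S S'}, IsOrderedSubset Y S → IsOrderedSubset Y S' →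
    (B S ⊆ B S' ↔ S <+: S')
  mem_iff : ∀ {S}, IsOrderedSubset Y S → ∀ {y}, y ∈ Y → (y ∈ B S ↔ y ∈ S)

theorem exists_injective_mem_orderEmbedding_iff [Finite α] (g : Finset α ↪o Finset Z) :
    ∃ x : α → Z, Function.Injective x ∧ ∀ A i, x i ∈ g A ↔ i ∈ A := by
  classical
  have := Fintype.ofFinite α
  have hwitness (i : α) : ∃ z, z ∈ g {i} ∧ z ∉ g {i}ᶜ :=
    Finset.not_subset.1 fun hle ↦ by simpa using g.le_iff_le.1 hle
  choose x hx hxc using hwitness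
  have hmem (A : Finset α) (i : α) : x i ∈ g A ↔ i ∈ A := by
    refine ⟨fun hi ↦ ?_, fun hi ↦ g.monotone (Finset.singleton_subset_iff.2 hi) (hx i)⟩
    by_contra hiA
    exact hxc i (g.monotone (Finset.subset_compl_comm.1 (by simpa using hiA)) hi)
  refine ⟨x, fun i j hij ↦ ?_, hmem⟩
  have hi := hx i
  rw [hij, hmem] at hi
  exact (Finset.mem_singleton.1 hi).symm

/-- Walk up the shrub from its root: at `B S`, move on to `B (S ++ [y])` for some `y ∈ Y \ S` lying
in the element of the cube which agrees with `B S` outside `Y`. When no such `y` is left, this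
element and `B S` coincide. -/
theorem IsShrub.exists_eq_of_monotone {B : List Z → Finset Z} (hB : IsShrub Y B) [Finite α]
    {g : Finset α → Finset Z} (hg : Monotone g) {x : α → Z} (hx : ∀ A i, x i ∈ g A ↔ i ∈ A)
    (hY : ∀ z, z ∉ Y → z ∈ Set.range x) : ∃ A S, IsOrderedSubset Y S ∧ g A = B S := by
  classical
  have := Fintype.ofFinite α
  let a (S : List Z) : Finset α := Finset.univ.filter fun i ↦ x i ∈ B S
  let s : Set (List Z) := {S | IsOrderedSubset Y S ∧ ∀ y ∈ S, y ∈ g (a S)}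
  obtain ⟨S, ⟨hS, hSg⟩, hmax⟩ : ∃ S, MaximalFor (· ∈ s) List.length S := by
    refine Set.Finite.exists_maximalFor' List.length s ((Set.finite_Iic Y.card).subset ?_)
      ⟨[], isOrderedSubset_nil, by simp⟩
    rintro _ ⟨S, hS, rfl⟩
    exact hS.1.length_le
  refine ⟨a S, S, hS, Finset.ext fun z ↦ ?_⟩
  by_cases hz : z ∈ Y
  · rw [hB.mem_iff hS hz]
    refine ⟨fun hzg ↦ ?_, hSg z⟩
    by_contra hzS
    have hS' := hS.concat hz hzS
    have hB_le : B S ⊆ B (S ++ [z]) := (hB.subset_iff_prefix hS hS').2 (List.prefix_append S [z])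
    have hle : a S ≤ a (S ++ [z]) := Finset.monotone_filter_right _ fun i _ hi ↦ hB_le hi
    have hS's : S ++ [z] ∈ s := ⟨hS', fun y hy ↦ hg hle <| by
      rcases List.mem_append.1 hy with hy | hy
      · exact hSg y hy
      · exact List.mem_singleton.1 hy ▸ hzg⟩
    simpa using hmax hS's (by simp)
  · obtain ⟨i, rfl⟩ := hY z hz
    simp [hx, a]

variable {ι : Type*} {Y : ι → Finset Z} {B : ι → List Z → Finset Z}

/-- The vertices of the `Y i`-shrubs `B i`. -/
def shrubVertices (Y : ι → Finset Z) (B : ι → List Z → Finset Z) : Set (Finset Z) :=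
  {A | ∃ i S, IsOrderedSubset (Y i) S ∧ B i S = A}

/-- A family of `Y i`-shrubs `B i` such that vertices of different shrubs are incomparable. -/
structure IsIncomparableShrubFamily (Y : ι → Finset Z) (B : ι → List Z → Finset Z) : Prop where
  isShrub : ∀ i, IsShrub (Y i) (B i)
  eq_of_subset : ∀ {i j S S'}, IsOrderedSubset (Y i) S → IsOrderedSubset (Y j) S' →
    B i S ⊆ B j S' → i = j

theorem IsIncomparableShrubFamily.subset_or_subset (hB : IsIncomparableShrubFamily Y B)
    {A A₁ A₂ : Finset Z} (hA : A ∈ shrubVertices Y B) (hA₁ : A₁ ∈ shrubVertices Y B)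
    (hA₂ : A₂ ∈ shrubVertices Y B) (h₁ : A₁ ⊆ A) (h₂ : A₂ ⊆ A) : A₁ ⊆ A₂ ∨ A₂ ⊆ A₁ := by
  obtain ⟨i, S, hS, rfl⟩ := hA
  obtain ⟨i₁, S₁, hS₁, rfl⟩ := hA₁
  obtain ⟨i₂, S₂, hS₂, rfl⟩ := hA₂
  obtain rfl := hB.eq_of_subset hS₁ hS h₁
  obtain rfl := hB.eq_of_subset hS₂ hS h₂
  simp only [(hB.isShrub _).subset_iff_prefix, hS, hS₁, hS₂] at h₁ h₂ ⊢
  exact List.prefix_or_prefix_of_prefix h₁ h₂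

theorem IsIncomparableShrubFamily.not_arrows_lambda [Finite α]
    (hB : IsIncomparableShrubFamily Y B)
    (hY : ∀ x : α → Z, Function.Injective x → ∃ i, ∀ z, z ∉ Y i → z ∈ Set.range x) :
    ¬ Arrows (Finset Z) PosetLambda (Finset α) := by
  intro h
  rcases arrows_iff_forall_set.1 h (shrubVertices Y B) with ⟨f, hf⟩ | ⟨g, hg⟩
  · obtain ⟨a, b, c, hb, hc, hbc, hcb⟩ := containsCopy_lambda_iff.1 ⟨RelEmbedding.refl _⟩
    exact (hB.subset_or_subset (hf a) (hf b) (hf c) (f.monotone hb) (f.monotone hc)).elim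
      (hbc ∘ f.le_iff_le.1) (hcb ∘ f.le_iff_le.1)
  · obtain ⟨x, hx, hxg⟩ := exists_injective_mem_orderEmbedding_iff g
    obtain ⟨i, hi⟩ := hY x hx
    obtain ⟨A, S, hS, hAS⟩ := (hB.isShrub i).exists_eq_of_monotone g.monotone hxg hi
    exact hg A ⟨i, S, hS, hAS.symm⟩

end Shrub

section ShrubConstruction

variable {Z α β : Type*} [Fintype Z] {k : ℕ}

open Classical in
/-- The vertex at the ordered subset `S` of a `Y`-shrub. It consists of an encoding by `u` of the
codeword `w`, cut off at `Y`, which identifies the shrub; of the elements of `S`; and, for each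
`j`, of an encoding by `v (j, ·)` of the codeword of the `j`-th element of `S`. Words are encoded
by including either `u (l, true)` or `u (l, false)`, so that different words have incomparable
encodings. -/
noncomputable def shrubVertex (u : α × Bool → Z) (v : Fin k × β × Bool → Z) (w : α → Bool)
    (d : Z → β → Bool) (Y : Finset Z) (S : List Z) : Finset Z :=
  Finset.univ.filter fun z ↦ (z ∉ Y ∧ ∃ l, u (l, w l) = z) ∨ z ∈ S ∨
    ∃ (j : Fin k) (y : Z) (t : β), S[j]? = some y ∧ v (j, t, d y t) = z

variable {u : α × Bool → Z} {v : Fin k × β × Bool → Z} {w w' : α → Bool} {d : Z → β → Bool}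
  {Y Y' : Finset Z} {S S' : List Z} {z : Z}

theorem mem_shrubVertex : z ∈ shrubVertex u v w d Y S ↔ (z ∉ Y ∧ ∃ l, u (l, w l) = z) ∨ z ∈ S ∨
    ∃ (j : Fin k) (y : Z) (t : β), S[j]? = some y ∧ v (j, t, d y t) = z := by
  simp only [shrubVertex, Finset.mem_filter, Finset.mem_univ, true_and]

theorem shrubVertex_subset_of_prefix (h : S <+: S') :
    shrubVertex u v w d Y S ⊆ shrubVertex u v w d Y S' := by
  intro z hz
  rw [mem_shrubVertex] at hz ⊢
  refine hz.imp_right (Or.imp (fun hz ↦ h.subset hz) ?_)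
  rintro ⟨j, y, t, hy, rfl⟩
  obtain ⟨hj, rfl⟩ := List.getElem?_eq_some_iff.1 hy
  exact ⟨j, S[j], t, List.prefix_iff_getElem?.1 h _ hj, rfl⟩

theorem mem_shrubVertex_iff_of_mem (hv : ∀ x, v x ∉ Y) (hz : z ∈ Y) :
    z ∈ shrubVertex u v w d Y S ↔ z ∈ S := by
  refine mem_shrubVertex.trans ⟨?_, fun h ↦ .inr (.inl h)⟩
  rintro (⟨hz', -⟩ | hS | ⟨j, y, t, -, rfl⟩)
  · exact absurd hz hz'
  · exact hS
  · exact absurd hz (hv _)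

theorem label_mem_shrubVertex_iff (huv : ∀ x y, u x ≠ v y) (hvi : Function.Injective v)
    (hv : ∀ x, v x ∉ Y) (hS : ∀ y ∈ S, y ∈ Y) {j : Fin k} {t : β} {c : Bool} :
    v (j, t, c) ∈ shrubVertex u v w d Y S ↔ ∃ y, S[j]? = some y ∧ d y t = c := by
  rw [mem_shrubVertex]
  constructor
  · rintro (⟨-, l, hl⟩ | hmem | ⟨j', y, t', hy, he⟩)
    · exact absurd hl (huv _ _)
    · exact absurd (hS _ hmem) (hv _)
    · simp only [hvi.eq_iff, Prod.mk.injEq] at he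
      obtain ⟨rfl, rfl, rfl⟩ := he
      exact ⟨y, hy, rfl⟩
  · rintro ⟨y, hy, rfl⟩
    exact .inr (.inr ⟨j, y, t, hy, rfl⟩)

theorem prefix_of_shrubVertex_subset [Nonempty β] (huv : ∀ x y, u x ≠ v y)
    (hvi : Function.Injective v) (hv : ∀ x, v x ∉ Y) (hd : Function.Injective d)
    (hk : S.length ≤ k) (hS : ∀ y ∈ S, y ∈ Y) (hS' : ∀ y ∈ S', y ∈ Y)
    (h : shrubVertex u v w d Y S ⊆ shrubVertex u v w d Y S') : S <+: S' := by
  refine List.prefix_iff_getElem?.2 fun i hi ↦ ?_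
  have hlabel (t : β) : ∃ y, S'[i]? = some y ∧ d y t = d S[i] t := by
    have hmem : v (⟨i, hi.trans_le hk⟩, t, d S[i] t) ∈ shrubVertex u v w d Y S :=
      (label_mem_shrubVertex_iff huv hvi hv hS).2 ⟨S[i], List.getElem?_eq_getElem hi, rfl⟩
    exact (label_mem_shrubVertex_iff huv hvi hv hS').1 (h hmem)
  obtain ⟨y, hy, -⟩ := hlabel (Classical.arbitrary β)
  have hyd : d y = d S[i] := funext fun t ↦ by
    obtain ⟨y', hy', hyt⟩ := hlabel t
    rwa [Option.some.inj (hy.symm.trans hy')]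
  rw [hy, hd hyd]

theorem isShrub_shrubVertex [Nonempty β] (huv : ∀ x y, u x ≠ v y) (hvi : Function.Injective v)
    (hv : ∀ x, v x ∉ Y) (hd : Function.Injective d) (hk : Y.card ≤ k) :
    IsShrub Y (shrubVertex u v w d Y) where
  subset_iff_prefix hS hS' :=
    ⟨prefix_of_shrubVertex_subset huv hvi hv hd (hS.length_le.trans hk) hS.2 hS'.2,
      shrubVertex_subset_of_prefix⟩
  mem_iff _ _ := mem_shrubVertex_iff_of_mem hv

theorem hammingDist_le_of_shrubVertex_subset [Fintype α] [DecidableEq Z]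
    {v' : Fin k × β × Bool → Z} (hui : Function.Injective u) (huv' : ∀ x y, u x ≠ v' y)
    (hS' : ∀ y ∈ S', y ∈ Y')
    (h : shrubVertex u v w d Y S ⊆ shrubVertex u v' w' d Y' S') :
    hammingDist w w' ≤ (Y ∪ Y').card := by
  refine Finset.card_le_card_of_injOn (fun l ↦ u (l, w l)) (fun l hl ↦ ?_)
    fun l _ l' _ hll ↦ congrArg Prod.fst (hui hll)
  by_contra hY
  simp only [Finset.coe_union, Set.mem_union, Finset.mem_coe, not_or] at hY
  have hmem := h (mem_shrubVertex.2 (.inl ⟨hY.1, l, rfl⟩))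
  rcases mem_shrubVertex.1 hmem with ⟨-, l', hl'⟩ | hmem | ⟨j, y, t, -, he⟩
  · simp only [hui.eq_iff, Prod.mk.injEq] at hl'
    obtain ⟨rfl, hw⟩ := hl'
    simp [hw] at hl
  · exact hY.2 (hS' _ hmem)
  · exact huv' _ _ he.symm

theorem exists_injective_forall_notMem_ne {γ δ : Type*} [Fintype γ] [Fintype δ] (Y : Finset Z)
    (u : γ → Z) (h : Y.card + Fintype.card γ + Fintype.card δ ≤ Fintype.card Z) :
    ∃ v : δ → Z, Function.Injective v ∧ (∀ y, v y ∉ Y) ∧ ∀ x y, u x ≠ v y := by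
  classical
  obtain ⟨v⟩ : Nonempty (δ ↪ ↥(Y ∪ Finset.univ.image u)ᶜ) := by
    refine Function.Embedding.nonempty_of_card_le ?_
    have hunion := Finset.card_union_le Y (Finset.univ.image u)
    have himage : (Finset.univ.image u).card ≤ Fintype.card γ := Finset.card_image_le
    rw [Fintype.card_coe, Finset.card_compl]
    omega
  have hv (y : δ) := Finset.mem_compl.1 (v y).2
  simp only [Finset.mem_union, Finset.mem_image, Finset.mem_univ, true_and, not_or,
    not_exists] at hv
  exact ⟨fun y ↦ v y, Subtype.val_injective.comp v.injective, fun y ↦ (hv y).1,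
    fun x y ↦ (hv y).2 x⟩

theorem exists_lt_hammingDist_powersetCard {k b : ℕ} (hZ : Fintype.card Z ≤ 2 ^ b)
    (hkb : 6 * (k * b) < 2 ^ b) :
    ∃ c : {Y : Finset Z // Y.card = k} → Fin (3 * (k * b)) → Bool,
      ∀ Y Y', Y ≠ Y' → 2 * k < hammingDist (c Y) (c Y') := by
  refine exists_lt_hammingDist (2 * k) ?_
  rw [Fintype.card_finset_len, Fintype.card_fin, Fintype.card_bool]
  calc (Fintype.card Z).choose k * (3 * (k * b) * 2 + 1) ^ (2 * k)
      ≤ (2 ^ b) ^ k * (2 ^ b) ^ (2 * k) := by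
        gcongr
        · exact (Nat.choose_le_pow _ _).trans (Nat.pow_le_pow_left hZ k)
        · omega
    _ = 2 ^ (3 * (k * b)) := by ring

theorem exists_isIncomparableShrubFamily {k b : ℕ} (hb : 0 < b) (hZ : Fintype.card Z ≤ 2 ^ b)
    (hkb : 8 * (k * b) + k ≤ Fintype.card Z) :
    ∃ B : {Y : Finset Z // Y.card = k} → List Z → Finset Z,
      IsIncomparableShrubFamily Subtype.val B := by
  classical
  have : NeZero b := ⟨hb.ne'⟩
  have := Nat.one_le_two_pow (n := b)
  obtain ⟨c, hc⟩ := exists_lt_hammingDist_powersetCard (Z := Z) (k := k) hZ (by omega)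
  obtain ⟨d⟩ : Nonempty (Z ↪ (Fin b → Bool)) :=
    Function.Embedding.nonempty_of_card_le (by simpa using hZ)
  obtain ⟨u⟩ : Nonempty (Fin (3 * (k * b)) × Bool ↪ Z) :=
    Function.Embedding.nonempty_of_card_le (by simp; omega)
  choose v hvi hvY huv using fun Y : {Y : Finset Z // Y.card = k} ↦
    exists_injective_forall_notMem_ne (δ := Fin k × Fin b × Bool) Y.1 u (by
      have : k * (b * 2) = 2 * (k * b) := by ring
      simp only [Fintype.card_prod, Fintype.card_fin, Fintype.card_bool, Y.2]
      omega)
  refine ⟨fun Y ↦ shrubVertex u (v Y) (c Y) d Y, fun Y ↦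
    isShrub_shrubVertex (huv Y) (hvi Y) (hvY Y) d.injective Y.2.le, fun {Y Y' S S'} _ hS' h ↦ ?_⟩
  by_contra hne
  have hdist := hammingDist_le_of_shrubVertex_subset u.injective (huv Y') hS'.2 h
  have hunion := Finset.card_union_le Y.1 Y'.1
  rw [Y.2, Y'.2] at hunion
  have := hc Y Y' hne
  omega

theorem not_arrows_lambda {n k b : ℕ} (hb : 0 < b) (hn : n + k ≤ 2 ^ b)
    (hkb : 8 * (k * b) ≤ n) :
    ¬ Arrows (BooleanLattice (n + k)) PosetLambda (BooleanLattice n) := by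
  obtain ⟨B, hB⟩ := exists_isIncomparableShrubFamily (Z := Fin (n + k)) (k := k) hb (by simpa)
    (by simpa)
  refine hB.not_arrows_lambda fun x hx ↦ ⟨⟨(Finset.univ.image x)ᶜ, ?_⟩, by simp⟩
  rw [Finset.card_compl, Finset.card_image_of_injective _ hx]
  simp

end ShrubConstruction

theorem Arrows.lambda_of_not_isTrivialPoset {L P Q : Type*} [BooleanAlgebra L] [PartialOrder P]
    [BooleanAlgebra Q] (h : Arrows L P Q) (hP : ¬ IsTrivialPoset P) : Arrows L PosetLambda Q := by
  rw [IsTrivialPoset, not_and_or, not_not, not_not, containsCopy_v_iff_dual] at hP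
  rcases hP with ⟨⟨f⟩⟩ | ⟨⟨f⟩⟩
  · exact h.mono_blue f
  · exact ((h.dual.mono_blue f).mono_host (OrderIso.compl L).symm.toOrderEmbedding).mono_red
      (OrderIso.compl Q).toOrderEmbedding

theorem not_isTrivialPoset_lambda : ¬ IsTrivialPoset PosetLambda :=
  fun h ↦ h.1 ⟨RelEmbedding.refl _⟩

theorem add_lt_posetRamsey_of_not_isTrivialPoset {P : Type*} [PartialOrder P] [Finite P]
    (hP : ¬ IsTrivialPoset P) {n k : ℕ} (hk : 8 * (k * (Nat.log 2 n + 2)) ≤ n) :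
    n + k < posetRamsey P (BooleanLattice n) := by
  refine lt_posetRamsey fun h ↦ not_arrows_lambda (b := Nat.log 2 n + 2) (by omega) ?_ hk
    (h.lambda_of_not_isTrivialPoset hP)
  have hlog := Nat.lt_pow_succ_log_self one_lt_two n
  have hkn : k ≤ k * (Nat.log 2 n + 2) := Nat.le_mul_of_pos_right k (by omega)
  rw [pow_succ] at hlog ⊢
  omega

theorem exists_mul_log_le_and_div_logb_le {n : ℕ} (hn : 2 ≤ n) :
    ∃ k : ℕ, 8 * (k * (Nat.log 2 n + 2)) ≤ n ∧
      (1 / 15 : ℝ) * ((n : ℝ) / Real.logb 2 (n : ℝ)) ≤ k + 1 := by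
  have hn' : (2 : ℝ) ≤ n := by exact_mod_cast hn
  set l := Real.logb 2 (n : ℝ)
  have hl1 : 1 ≤ l := (Real.le_logb_iff_rpow_le one_lt_two (by linarith)).2 (by simpa)
  set r : ℝ := (1 / 15 : ℝ) * ((n : ℝ) / l) with hr
  have hr0 : 0 < r := by positivity
  have hrl : 15 * (r * l) = n := by rw [hr]; field_simp
  obtain ⟨k, hk⟩ := Nat.exists_eq_succ_of_ne_zero (Nat.ceil_pos.2 hr0).ne'
  have hkr : (k : ℝ) < r := Nat.lt_ceil.1 (by omega)
  refine ⟨k, ?_, by exact_mod_cast hk ▸ Nat.le_ceil r⟩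
  rcases Nat.eq_zero_or_pos k with rfl | hk0
  · simp
  have hn15 : 15 < n := by
    have hk1 : (1 : ℝ) ≤ k := by exact_mod_cast hk0
    have : (15 : ℝ) < n := by nlinarith
    exact_mod_cast this
  have hl4 : 4 ≤ l := (Real.le_logb_iff_rpow_le one_lt_two (by linarith)).2 (by
    norm_num
    exact hn15)
  have hlog : (Nat.log 2 n : ℝ) ≤ l := Real.natLog_le_logb n 2
  have : (8 * (k * (Nat.log 2 n + 2)) : ℝ) ≤ n := calc
    (8 * (k * (Nat.log 2 n + 2)) : ℝ) ≤ 8 * (r * (15 / 8 * l)) := by gcongr; linarith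
    _ = n := by linarith
  exact_mod_cast this

theorem le_posetRamsey_of_not_isTrivialPoset {P : Type*} [PartialOrder P] [Finite P]
    (hP : ¬ IsTrivialPoset P) {n : ℕ} (hn : 2 ≤ n) :
    (n : ℝ) + (1 / 15 : ℝ) * ((n : ℝ) / Real.logb 2 (n : ℝ)) ≤
      (posetRamsey P (BooleanLattice n) : ℝ) := by
  obtain ⟨k, hk, hle⟩ := exists_mul_log_le_and_div_logb_le hn
  have hlt : (n + k + 1 : ℝ) ≤ posetRamsey P (BooleanLattice n) := by
    exact_mod_cast add_lt_posetRamsey_of_not_isTrivialPoset hP hk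
  linarith

theorem mainTheorem1_general (P : Type*) [PartialOrder P] [Finite P] [Nonempty P] :
    (IsTrivialPoset P ↔ IsParallelCompositionOfChains P) ∧
    (∀ n : ℕ, n + posetHeight P - 1 ≤ posetRamsey P (BooleanLattice n)) ∧
    (IsTrivialPoset P →
      (∀ n : ℕ, posetRamsey P (BooleanLattice n) ≤
        n + posetHeight P + spernerNumber (posetWidth P) - 1) ∧
      ((fun n : ℕ ↦ (posetRamsey P (BooleanLattice n) : ℝ) - (n : ℝ))
        =O[atTop] (fun _ : ℕ ↦ (1 : ℝ))) ∧
      (2 ≤ Nat.card P →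
        (fun n : ℕ ↦ (posetRamsey P (BooleanLattice n) : ℝ) - (n : ℝ))
          =Θ[atTop] (fun _ : ℕ ↦ (1 : ℝ)))) ∧
    (¬ IsTrivialPoset P →
      ∀ n : ℕ, 2 ≤ n →
        (n : ℝ) + (1 / 15 : ℝ) * ((n : ℝ) / Real.logb 2 (n : ℝ)) ≤
          (posetRamsey P (BooleanLattice n) : ℝ)) := by
  refine ⟨isTrivialPoset_iff_isParallelCompositionOfChains,
    add_posetHeight_sub_one_le_posetRamsey P,
    fun hP ↦ ⟨hP.posetRamsey_le, hP.isBigO_posetRamsey_sub, fun hcard ↦ ?_⟩,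
    fun hP n hn ↦ le_posetRamsey_of_not_isTrivialPoset hP hn⟩
  have : Nontrivial P := Finite.one_lt_card_iff_nontrivial.1 hcard
  exact hP.isTheta_posetRamsey_sub

theorem mainTheorem1 :
    (∀ (P : Type*) [PartialOrder P] [Finite P] [Nonempty P],
      (IsTrivialPoset P ↔ IsParallelCompositionOfChains P) ∧
      (IsTrivialPoset P →
        (∀ n : ℕ, 1 ≤ n →
          n + posetHeight P - 1 ≤ posetRamsey P (BooleanLattice n) ∧
          posetRamsey P (BooleanLattice n) ≤
            n + posetHeight P + spernerNumber (posetWidth P) - 1) ∧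
        ((fun n : ℕ ↦ (posetRamsey P (BooleanLattice n) : ℝ) - (n : ℝ))
          =O[atTop] (fun _ : ℕ ↦ (1 : ℝ))) ∧
        (2 ≤ Nat.card P →
          (fun n : ℕ ↦ (posetRamsey P (BooleanLattice n) : ℝ) - (n : ℝ))
            =Θ[atTop] (fun _ : ℕ ↦ (1 : ℝ)))) ∧
      (¬ IsTrivialPoset P →
        ∀ n : ℕ, 2 ^ 16 ≤ n →
          (n : ℝ) + (1 / 15 : ℝ) * ((n : ℝ) / Real.logb 2 (n : ℝ)) ≤
            (posetRamsey P (BooleanLattice n) : ℝ))) ∧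
    (∀ n : ℕ, 2 ^ 16 ≤ n →
      (n : ℝ) + (1 / 15 : ℝ) * ((n : ℝ) / Real.logb 2 (n : ℝ)) ≤
        (posetRamsey PosetLambda (BooleanLattice n) : ℝ)) := by
  refine ⟨fun P _ _ _ ↦ ?_, fun n hn ↦ ?_⟩
  · obtain ⟨hiff, hlower, htrivial, hnontrivial⟩ := mainTheorem1_general P
    exact ⟨hiff, fun hP ↦ ⟨fun n _ ↦ ⟨hlower n, (htrivial hP).1 n⟩, (htrivial hP).2⟩,
      fun hP n hn ↦ hnontrivial hP n (le_trans (by norm_num) hn)⟩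
  · exact le_posetRamsey_of_not_isTrivialPoset not_isTrivialPoset_lambda
      (le_trans (by norm_num) hn)
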